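/- Let $N\ge 3$, let $\Omega\subset\mathbb R^N$ be a bounded domain with smooth boundary, let $\gamma>0$, and let $a\in L^1(\Omega)$ with $a>0$ a.e. in $\Omega$. Let $f:[0,\infty)\to[0,\infty)$ be continuous, with $\lim_{s\to\infty} f(s)/s=\theta$ for some $\theta\in(0,\infty)$ and with $s\mapsto f(s)/s$ non-increasing on $(0,\infty)$. Let $\delta_1$ be the smallest eigenvalue of $(-\Delta,H_0^1(\Omega))$, that is, the smallest $\mu\in\mathbb R$ for which there is a nonzero $\varphi\in H_0^1(\Omega)$ with $\int_\Omega\nabla\varphi\cdot\nabla\psi=\mu\int_\Omega\varphi\psi$ for all $\psi\in H_0^1(\Omega)$, and put $\lambda_*=\delta_1/\theta$. For a real parameter $\lambda$, a (weak) solution of $$(P)_\lambda\qquad -\Delta u=a(x)u^{-\gamma}+\lambda f(u)\ \text{ in }\Omega,\qquad u>0\ \text{ in }\Omega,\qquad u=0\ \text{ on }\partial\Omega,$$ is a function $u\in H_0^1(\Omega)$ with $u>0$ a.e. in $\Omega$ such that, for every $\phi\in H_0^1(\Omega)$, $a u^{-\gamma}\phi\in L^1(\Omega)$ and $$\int_\Omega\nabla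 u\cdot\nabla\phi=\int_\Omega a u^{-\gamma}\phi+\lambda\int_\Omega f(u)\phi .$$ If $\lambda\ge 0$ and $(P)_\lambda$ has a solution, then $0\le\lambda<\lambda_*$. Consequently $(P)_\lambda$ has no solution for any $\lambda\ge\lambda_*$. -/

import Mathlib

open MeasureTheory Filter Topology
open scoped ContDiff Gradient

namespace SingularElliptic

/-- The boundary of the open set `Ω` is smooth: near each of its boundary points, `Ω` is the
sublevel set `{ρ < 0}` of a smooth function `ρ` with nowhere vanishing gradient. -/
def HasSmoothBoundary {N : ℕ} (Ω : Set (EuclideanSpace ℝ (Fin N))) : Prop :=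
  ∀ x ∈ frontier Ω, ∃ (U : Set (EuclideanSpace ℝ (Fin N))) (ρ : EuclideanSpace ℝ (Fin N) → ℝ),
    IsOpen U ∧ x ∈ U ∧ ContDiffOn ℝ ∞ ρ U ∧ (∀ y ∈ U, ∇ ρ y ≠ 0) ∧
      Ω ∩ U = {y ∈ U | ρ y < 0}

/-- `Ω` is a bounded domain (nonempty, open, connected) with smooth boundary. -/
structure IsSmoothBoundedDomain {N : ℕ} (Ω : Set (EuclideanSpace ℝ (Fin N))) : Prop where
  isOpen : IsOpen Ω
  isConnected : IsConnected Ω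
  isBounded : Bornology.IsBounded Ω
  hasSmoothBoundary : HasSmoothBoundary Ω

/-- `ψ ∈ C_c^∞(Ω)`. -/
def IsTestFunction {N : ℕ} (Ω : Set (EuclideanSpace ℝ (Fin N)))
    (ψ : EuclideanSpace ℝ (Fin N) → ℝ) : Prop :=
  ContDiff ℝ ∞ ψ ∧ HasCompactSupport ψ ∧ tsupport ψ ⊆ Ω

/-- `u ∈ H¹(Ω)` with weak gradient `g`: both are square integrable on `Ω` and
`∫_Ω u ∇ψ = - ∫_Ω ψ g` for every `ψ ∈ C_c^∞(Ω)`. -/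
def MemH1 {N : ℕ} (Ω : Set (EuclideanSpace ℝ (Fin N)))
    (u : EuclideanSpace ℝ (Fin N) → ℝ)
    (g : EuclideanSpace ℝ (Fin N) → EuclideanSpace ℝ (Fin N)) : Prop :=
  MemLp u 2 (volume.restrict Ω) ∧ MemLp g 2 (volume.restrict Ω) ∧
    ∀ ψ, IsTestFunction Ω ψ → ∫ x in Ω, u x • ∇ ψ x = - ∫ x in Ω, ψ x • g x

/-- `u ∈ H₀¹(Ω)` with weak gradient `g`: `u` lies in `H¹(Ω)`, has weak gradient `g`, and is the
limit in the norm of `H¹(Ω)` of a sequence in `C_c^∞(Ω)`. Values outside `Ω` play no role, and `g`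
is determined by `u` almost everywhere in `Ω`. -/
def MemH10 {N : ℕ} (Ω : Set (EuclideanSpace ℝ (Fin N)))
    (u : EuclideanSpace ℝ (Fin N) → ℝ)
    (g : EuclideanSpace ℝ (Fin N) → EuclideanSpace ℝ (Fin N)) : Prop :=
  MemH1 Ω u g ∧ ∃ ψ : ℕ → EuclideanSpace ℝ (Fin N) → ℝ, (∀ n, IsTestFunction Ω (ψ n)) ∧
    Tendsto (fun n => eLpNorm (fun x => ψ n x - u x) 2 (volume.restrict Ω)) atTop (𝓝 0) ∧
    Tendsto (fun n => eLpNorm (fun x => ∇ (ψ n) x - g x) 2 (volume.restrict Ω)) atTop (𝓝 0)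

/-- `μ` is an eigenvalue of `(-Δ, H₀¹(Ω))`: some nonzero `φ ∈ H₀¹(Ω)` satisfies
`∫_Ω ∇φ·∇ψ = μ ∫_Ω φ ψ` for every `ψ ∈ H₀¹(Ω)`. -/
def IsDirichletEigenvalue {N : ℕ} (Ω : Set (EuclideanSpace ℝ (Fin N))) (μ : ℝ) : Prop :=
  ∃ φ g, MemH10 Ω φ g ∧ ¬ φ =ᵐ[volume.restrict Ω] 0 ∧
    ∀ ψ h, MemH10 Ω ψ h → ∫ x in Ω, inner ℝ (g x) (h x) = μ * ∫ x in Ω, φ x * ψ x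

/-- `u` is a weak solution of `-Δu = a u^(-γ) + lam f(u)` in `Ω`, `u > 0` in `Ω`, `u = 0` on
the boundary of `Ω`. -/
def IsSolution {N : ℕ} (Ω : Set (EuclideanSpace ℝ (Fin N))) (γ : ℝ)
    (a : EuclideanSpace ℝ (Fin N) → ℝ) (f : ℝ → ℝ) (lam : ℝ)
    (u : EuclideanSpace ℝ (Fin N) → ℝ) : Prop :=
  (∀ᵐ x ∂(volume.restrict Ω), 0 < u x) ∧
  ∃ g, MemH10 Ω u g ∧ ∀ φ h, MemH10 Ω φ h →
    IntegrableOn (fun x => a x * u x ^ (-γ) * φ x) Ω ∧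
    ∫ x in Ω, inner ℝ (g x) (h x) =
      (∫ x in Ω, a x * u x ^ (-γ) * φ x) + lam * ∫ x in Ω, f (u x) * φ x

end SingularElliptic

/-!
A positive solution `u` of `-Δu = a u^(-γ) + lam f(u)` is a strict positive supersolution of a
linear problem: since `f s / s` decreases to `θ`, one has `f u ≥ θ u`, so
`-Δu ≥ a u^(-γ) + lam θ u`. The existence of such a supersolution bounds the Dirichlet form from
below. Testing with `ψ² / (u + ε)` and using Picone's inequality
`∇u · ∇(ψ² / (u + ε)) ≤ |∇ψ|²` gives, for test functions `ψ`,
`∫ (a u^(-γ) + lam θ u) / (u + ε) ψ² ≤ ∫ |∇ψ|²` (`IsSolution.lintegral_le`). Fatou's lemma, along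
test functions converging to `φ` and `ε → 0`, yields
`∫ (a u^(-γ-1) + lam θ) φ² ≤ ∫ |∇φ|²` on `H₀¹(Ω)` (`IsSolution.lintegral_le_of_memH10`). For an
eigenfunction `φ` of eigenvalue `δ` the right-hand side is `δ ∫ φ²`, and as `a u^(-γ-1) > 0` this
forces `lam θ < δ` (`IsSolution.mul_lt_of_isDirichletEigenvalue`).

The argument needs neither a positive first eigenfunction nor the variational
characterization of `δ₁`, hence no compactness of `H₀¹(Ω) ⊂ L²(Ω)`. Its technical part is that
`ψ² / (u + ε)` lies in `H₀¹(Ω)`. The approximants of `u` may be negative, so `s ↦ (s + ε)⁻¹` is first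
extended from `[0, ∞)` to a smooth function on `ℝ`, bounded with its derivative
(`exists_smooth_inv_add`), for which a chain rule holds in `H₀¹(Ω)` (`MemH10.mul_comp`).
-/

namespace SingularElliptic

variable {N : ℕ} {Ω : Set (EuclideanSpace ℝ (Fin N))}

/-! ### Test functions -/

theorem IsTestFunction.eq_zero_of_notMem {ψ : EuclideanSpace ℝ (Fin N) → ℝ}
    (hψ : IsTestFunction Ω ψ) {x : EuclideanSpace ℝ (Fin N)} (hx : x ∉ Ω) : ψ x = 0 :=
  image_eq_zero_of_notMem_tsupport fun h => hx (hψ.2.2 h)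

theorem IsTestFunction.differentiable {ψ : EuclideanSpace ℝ (Fin N) → ℝ}
    (hψ : IsTestFunction Ω ψ) : Differentiable ℝ ψ :=
  hψ.1.differentiable (by simp)

theorem IsTestFunction.continuous_gradient {ψ : EuclideanSpace ℝ (Fin N) → ℝ}
    (hψ : IsTestFunction Ω ψ) : Continuous (∇ ψ) :=
  (InnerProductSpace.toDual ℝ (EuclideanSpace ℝ (Fin N))).symm.continuous.comp
    (hψ.1.continuous_fderiv (by simp))

theorem IsTestFunction.hasCompactSupport_gradient {ψ : EuclideanSpace ℝ (Fin N) → ℝ}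
    (hψ : IsTestFunction Ω ψ) : HasCompactSupport (∇ ψ) :=
  (hψ.2.1.fderiv (𝕜 := ℝ)).comp_left
    (g := (InnerProductSpace.toDual ℝ (EuclideanSpace ℝ (Fin N))).symm) (map_zero _)

theorem IsTestFunction.memLp {ψ : EuclideanSpace ℝ (Fin N) → ℝ} (hψ : IsTestFunction Ω ψ)
    (p : ENNReal) : MemLp ψ p (volume.restrict Ω) :=
  (hψ.1.continuous.memLp_of_hasCompactSupport hψ.2.1).restrict Ω

theorem IsTestFunction.memLp_gradient {ψ : EuclideanSpace ℝ (Fin N) → ℝ}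
    (hψ : IsTestFunction Ω ψ) (p : ENNReal) : MemLp (∇ ψ) p (volume.restrict Ω) :=
  (hψ.continuous_gradient.memLp_of_hasCompactSupport hψ.hasCompactSupport_gradient).restrict Ω

theorem IsTestFunction.exists_bound {ψ : EuclideanSpace ℝ (Fin N) → ℝ}
    (hψ : IsTestFunction Ω ψ) : ∃ C, 0 ≤ C ∧ ∀ x, |ψ x| ≤ C ∧ ‖∇ ψ x‖ ≤ C := by
  obtain ⟨C₁, h₁⟩ := hψ.2.1.exists_bound_of_continuous hψ.1.continuous
  obtain ⟨C₂, h₂⟩ := hψ.hasCompactSupport_gradient.exists_bound_of_continuous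
    hψ.continuous_gradient
  exact ⟨max C₁ C₂, (norm_nonneg _).trans ((h₁ 0).trans (le_max_left _ _)), fun x =>
    ⟨(h₁ x).trans (le_max_left _ _), (h₂ x).trans (le_max_right _ _)⟩⟩

theorem IsTestFunction.mul_comp {χ w : EuclideanSpace ℝ (Fin N) → ℝ} {G : ℝ → ℝ}
    (hχ : IsTestFunction Ω χ) (hw : ContDiff ℝ ∞ w) (hG : ContDiff ℝ ∞ G) :
    IsTestFunction Ω (fun x => χ x * G (w x)) :=
  ⟨hχ.1.mul (hG.comp hw), hχ.2.1.mul_right, (tsupport_mul_subset_left).trans hχ.2.2⟩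

theorem gradient_mul_comp {χ w : EuclideanSpace ℝ (Fin N) → ℝ} {G : ℝ → ℝ}
    (hχ : Differentiable ℝ χ) (hw : Differentiable ℝ w) (hG : Differentiable ℝ G)
    (x : EuclideanSpace ℝ (Fin N)) :
    ∇ (fun x => χ x * G (w x)) x = G (w x) • ∇ χ x + (χ x * deriv G (w x)) • ∇ w x := by
  have h1 : HasFDerivAt (fun x => χ x * G (w x))
      (χ x • (deriv G (w x) • fderiv ℝ w x) + G (w x) • fderiv ℝ χ x) x :=
    (hχ x).hasFDerivAt.mul ((hG (w x)).hasDerivAt.comp_hasFDerivAt x (hw x).hasFDerivAt)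
  rw [gradient, h1.fderiv, map_add, map_smul, map_smul, map_smul, smul_smul, add_comm]
  rfl

theorem integral_smul_gradient {v ψ : EuclideanSpace ℝ (Fin N) → ℝ}
    (hv : IsTestFunction Ω v) (hψ : IsTestFunction Ω ψ) :
    ∫ x in Ω, v x • ∇ ψ x = - ∫ x in Ω, ψ x • ∇ v x := by
  have aux : ∀ {v ψ : EuclideanSpace ℝ (Fin N) → ℝ}, IsTestFunction Ω v → IsTestFunction Ω ψ →
      Integrable (fun x => v x • ∇ ψ x) := fun hv hψ =>
    (hv.1.continuous.smul hψ.continuous_gradient).integrable_of_hasCompactSupport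
      hv.2.1.smul_right
  rw [setIntegral_eq_integral_of_forall_compl_eq_zero
      (fun x hx => by rw [hv.eq_zero_of_notMem hx, zero_smul]),
    setIntegral_eq_integral_of_forall_compl_eq_zero
      (fun x hx => by rw [hψ.eq_zero_of_notMem hx, zero_smul])]
  refine ext_inner_left ℝ fun e => ?_
  rw [inner_neg_right, ← integral_inner (aux hv hψ), ← integral_inner (aux hψ hv)]
  have h1 := (aux hv hψ).const_inner (𝕜 := ℝ) e
  have h2 := (aux hψ hv).const_inner (𝕜 := ℝ) e
  simp only [inner_smul_right, inner_gradient_right, conj_trivial] at h1 h2 ⊢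
  rw [integral_mul_fderiv_eq_neg_fderiv_mul_of_integrable (f := v) (g := ψ)]
  · simp only [mul_comm]
  · simpa only [mul_comm] using h2
  · exact h1
  · exact (hv.1.continuous.mul hψ.1.continuous).integrable_of_hasCompactSupport
      hv.2.1.mul_right
  · exact fun x _ => hv.differentiable x
  · exact fun x _ => hψ.differentiable x

/-! ### Limits of test functions -/

/-- Convergence in `L¹` of products of `L²` functions carries over to their integrals. -/
theorem tendsto_integral_smul {E : Type*} [NormedAddCommGroup E] [NormedSpace ℝ E]
    {α : Type*} [MeasurableSpace α] {μ : Measure α} {w : ℕ → α → ℝ} {k : ℕ → α → E}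
    {w' : α → ℝ} {k' : α → E}
    (hw : ∀ n, MemLp (w n) 2 μ) (hw' : MemLp w' 2 μ) (hk : ∀ n, MemLp (k n) 2 μ)
    (hk' : MemLp k' 2 μ)
    (h : Tendsto (fun n => eLpNorm (fun x => w n x • k n x - w' x • k' x) 1 μ) atTop (𝓝 0)) :
    Tendsto (fun n => ∫ x, w n x • k n x ∂μ) atTop (𝓝 (∫ x, w' x • k' x ∂μ)) := by
  refine tendsto_integral_of_L1' _ (MemLp.smul (r := 1) hk' hw').1
    (Eventually.of_forall fun n => ?_) h
  exact memLp_one_iff_integrable.1 (MemLp.smul (r := 1) (hk n) (hw n))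

/-- The integration by parts formula survives `H¹` limits, so an `H¹` limit of test functions
belongs to `H₀¹(Ω)` as soon as it and its gradient are square integrable. -/
theorem memH10_of_tendsto {v : EuclideanSpace ℝ (Fin N) → ℝ}
    {h : EuclideanSpace ℝ (Fin N) → EuclideanSpace ℝ (Fin N)}
    (hv : MemLp v 2 (volume.restrict Ω)) (hh : MemLp h 2 (volume.restrict Ω))
    (w : ℕ → EuclideanSpace ℝ (Fin N) → ℝ) (hw : ∀ n, IsTestFunction Ω (w n))
    (h1 : Tendsto (fun n => eLpNorm (fun x => w n x - v x) 2 (volume.restrict Ω)) atTop (𝓝 0))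
    (h2 : Tendsto (fun n => eLpNorm (fun x => ∇ (w n) x - h x) 2 (volume.restrict Ω)) atTop
      (𝓝 0)) :
    MemH10 Ω v h := by
  refine ⟨⟨hv, hh, fun ψ hψ => ?_⟩, w, hw, h1, h2⟩
  have hψL := hψ.memLp 2
  have hψG := hψ.memLp_gradient 2
  have l1 : Tendsto (fun n => ∫ x in Ω, w n x • ∇ ψ x) atTop (𝓝 (∫ x in Ω, v x • ∇ ψ x)) := by
    refine tendsto_integral_smul (fun n => (hw n).memLp 2) hv (fun _ => hψG) hψG ?_
    refine tendsto_of_tendsto_of_tendsto_of_le_of_le tendsto_const_nhds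
      (h := fun n => eLpNorm (fun x => w n x - v x) 2 (volume.restrict Ω) *
        eLpNorm (∇ ψ) 2 (volume.restrict Ω)) ?_ (fun _ => zero_le) fun n => ?_
    · simpa using ENNReal.Tendsto.mul_const h1 (Or.inr hψG.eLpNorm_ne_top)
    · refine le_trans (le_of_eq ?_) (eLpNorm_smul_le_mul_eLpNorm (p := 2) (q := 2) (r := 1) hψG.1
        (((hw n).memLp 2).sub hv).1)
      congr 1
      ext1 x
      exact (sub_smul _ _ _).symm
  have l2 : Tendsto (fun n => ∫ x in Ω, ψ x • ∇ (w n) x) atTop (𝓝 (∫ x in Ω, ψ x • h x)) := by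
    refine tendsto_integral_smul (fun _ => hψL) hψL (fun n => (hw n).memLp_gradient 2) hh ?_
    refine tendsto_of_tendsto_of_tendsto_of_le_of_le tendsto_const_nhds
      (h := fun n => eLpNorm ψ 2 (volume.restrict Ω) *
        eLpNorm (fun x => ∇ (w n) x - h x) 2 (volume.restrict Ω)) ?_ (fun _ => zero_le)
        fun n => ?_
    · simpa using ENNReal.Tendsto.const_mul h2 (Or.inr hψL.eLpNorm_ne_top)
    · refine le_trans (le_of_eq ?_) (eLpNorm_smul_le_mul_eLpNorm (p := 2) (q := 2) (r := 1)
        (((hw n).memLp_gradient 2).sub hh).1 hψL.1)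
      congr 1
      ext1 x
      exact (smul_sub _ _ _).symm
  refine tendsto_nhds_unique l1 ?_
  simp_rw [fun n => integral_smul_gradient (hw n) hψ]
  exact l2.neg

theorem exists_ae_tendsto_of_eLpNorm {α E : Type*} [MeasurableSpace α] {μ : Measure α}
    [NormedAddCommGroup E] {w : ℕ → α → E} {v : α → E}
    (hw : ∀ n, MemLp (w n) 2 μ) (hv : MemLp v 2 μ)
    (h : Tendsto (fun n => eLpNorm (fun x => w n x - v x) 2 μ) atTop (𝓝 0)) :
    ∃ ns : ℕ → ℕ, StrictMono ns ∧ ∀ᵐ x ∂μ, Tendsto (fun i => w (ns i) x) atTop (𝓝 (v x)) :=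
  (tendstoInMeasure_of_tendsto_eLpNorm two_ne_zero (fun n => (hw n).1) hv.1 h).exists_seq_tendsto_ae

/-- Dominated convergence in `L²`, in the form of bounded multipliers of a fixed function. -/
theorem tendsto_eLpNorm_smul {α E : Type*} [MeasurableSpace α] {μ : Measure α}
    [NormedAddCommGroup E] [NormedSpace ℝ E] {m : ℕ → α → ℝ} {g : α → E} {C : ℝ}
    (hm : ∀ n, AEStronglyMeasurable (m n) μ) (hg : MemLp g 2 μ) (hC : ∀ n x, |m n x| ≤ C)
    (h0 : ∀ᵐ x ∂μ, Tendsto (fun n => m n x) atTop (𝓝 0)) :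
    Tendsto (fun n => eLpNorm (fun x => m n x • g x) 2 μ) atTop (𝓝 0) := by
  have key : Tendsto (fun n => ∫⁻ x, ‖m n x • g x‖ₑ ^ (2 : ℝ) ∂μ) atTop (𝓝 (∫⁻ _, 0 ∂μ)) := by
    refine tendsto_lintegral_of_dominated_convergence'
      (bound := fun x => ‖C • g x‖ₑ ^ (2 : ℝ)) ?_ ?_ ?_ ?_
    · exact fun n => ((hm n).smul hg.1).enorm.pow_const _
    · refine fun n => Eventually.of_forall fun x => ?_
      dsimp only
      rw [enorm_smul, enorm_smul]
      gcongr
      rw [← ofReal_norm, ← ofReal_norm]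
      exact ENNReal.ofReal_le_ofReal ((hC n x).trans (le_abs_self C))
    · have := (hg.const_smul C).eLpNorm_lt_top
      rw [eLpNorm_lt_top_iff_lintegral_rpow_enorm_lt_top two_ne_zero ENNReal.ofNat_ne_top] at this
      exact this.ne
    · filter_upwards [h0] with x hx
      have h1 : Tendsto (fun n => ‖m n x • g x‖ₑ) atTop (𝓝 0) := by
        simpa using (hx.smul_const (g x)).enorm
      simpa [Function.comp_def] using
        (ENNReal.continuous_rpow_const (y := (2 : ℝ))).continuousAt.tendsto.comp h1
  simp only [lintegral_zero] at key
  have := (ENNReal.continuous_rpow_const (y := (1 / 2 : ℝ))).continuousAt.tendsto.comp key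
  simpa [eLpNorm_eq_lintegral_rpow_enorm_toReal two_ne_zero ENNReal.ofNat_ne_top,
    Function.comp_def] using this

/-! ### Chain and product rule in `H₀¹(Ω)` -/

theorem abs_sub_le_of_abs_deriv_le {G : ℝ → ℝ} {C : ℝ} (hG : Differentiable ℝ G)
    (hC : ∀ s, |deriv G s| ≤ C) (s t : ℝ) : |G s - G t| ≤ C * |s - t| :=
  convex_univ.norm_image_sub_le_of_norm_deriv_le (fun x _ => hG x) (fun x _ => hC x)
    (Set.mem_univ t) (Set.mem_univ s)

/-- If `u ∈ H₀¹(Ω)`, `χ ∈ C_c^∞(Ω)` and `G` is smooth and bounded together with its derivative,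
then `χ G(u)` belongs to `H₀¹(Ω)`, with the gradient given by the usual rules. -/
theorem MemH10.mul_comp {u : EuclideanSpace ℝ (Fin N) → ℝ}
    {g : EuclideanSpace ℝ (Fin N) → EuclideanSpace ℝ (Fin N)} (hu : MemH10 Ω u g)
    {χ : EuclideanSpace ℝ (Fin N) → ℝ} (hχ : IsTestFunction Ω χ) {G : ℝ → ℝ} {C : ℝ}
    (hG : ContDiff ℝ ∞ G) (hC : ∀ s, |G s| ≤ C) (hC' : ∀ s, |deriv G s| ≤ C) :
    MemH10 Ω (fun x => χ x * G (u x))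
      (fun x => G (u x) • ∇ χ x + (χ x * deriv G (u x)) • g x) := by
  obtain ⟨⟨huL, hgL, -⟩, w, hw, hwu, hwg⟩ := hu
  obtain ⟨ns, hns, hae⟩ := exists_ae_tendsto_of_eLpNorm (fun n => (hw n).memLp 2) huL hwu
  obtain ⟨K, hK0, hK⟩ := hχ.exists_bound
  have hC0 : 0 ≤ C := (abs_nonneg _).trans (hC 0)
  have hGd : Differentiable ℝ G := hG.differentiable (by simp)
  have hG' : Continuous (deriv G) := hG.continuous_deriv (by simp)
  have hlip := abs_sub_le_of_abs_deriv_le hGd hC'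
  have hχm : AEStronglyMeasurable χ (volume.restrict Ω) := (hχ.memLp 2).1
  have hmG : AEStronglyMeasurable (fun x => G (u x)) (volume.restrict Ω) :=
    hG.continuous.comp_aestronglyMeasurable huL.1
  have hmG' : AEStronglyMeasurable (fun x => deriv G (u x)) (volume.restrict Ω) :=
    hG'.comp_aestronglyMeasurable huL.1
  have hmw : ∀ n, AEStronglyMeasurable (fun x => deriv G (w n x)) (volume.restrict Ω) :=
    fun n => hG'.comp_aestronglyMeasurable ((hw n).memLp 2).1
  replace hwu := hwu.comp hns.tendsto_atTop
  replace hwg := hwg.comp hns.tendsto_atTop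
  refine memH10_of_tendsto ?_ (MemLp.add ?_ ?_) (fun n x => χ x * G (w (ns n) x))
    (fun n => hχ.mul_comp (hw _).1 hG) ?_ ?_
  · refine (hχ.memLp 2).of_le_mul (c := C) (hχm.mul hmG) (Eventually.of_forall fun x => ?_)
    rw [norm_mul, mul_comm]
    gcongr
    exact hC _
  · refine (hχ.memLp_gradient 2).of_le_mul (c := C) (hmG.smul (hχ.memLp_gradient 2).1)
      (Eventually.of_forall fun x => ?_)
    rw [norm_smul]
    gcongr
    exact hC _
  · refine hgL.of_le_mul (c := K * C) ((hχm.mul hmG').smul hgL.1)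
      (Eventually.of_forall fun x => ?_)
    rw [norm_smul, norm_mul]
    gcongr
    exacts [(hK x).1, hC' _]
  · refine tendsto_of_tendsto_of_tendsto_of_le_of_le tendsto_const_nhds
      (h := fun n => ENNReal.ofReal (K * C) *
        eLpNorm (fun x => w (ns n) x - u x) 2 (volume.restrict Ω)) ?_ (fun _ => zero_le)
      fun n => ?_
    · simpa using ENNReal.Tendsto.const_mul hwu (Or.inr ENNReal.ofReal_ne_top)
    · refine eLpNorm_le_mul_eLpNorm_of_ae_le_mul (Eventually.of_forall fun x => ?_) 2
      rw [← mul_sub, norm_mul, mul_assoc]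
      exact mul_le_mul (hK x).1 (hlip _ _) (abs_nonneg _) hK0
  · have e : ∀ n, (fun x => ∇ (fun x => χ x * G (w (ns n) x)) x -
        (G (u x) • ∇ χ x + (χ x * deriv G (u x)) • g x)) =
        ((fun x => (G (w (ns n) x) - G (u x)) • ∇ χ x) +
          (fun x => (χ x * deriv G (w (ns n) x)) • (∇ (w (ns n)) x - g x))) +
          (fun x => (χ x * (deriv G (w (ns n) x) - deriv G (u x))) • g x) := by
      intro n
      ext1 x
      rw [gradient_mul_comp hχ.differentiable (hw _).differentiable hGd]
      simp only [Pi.add_apply]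
      module
    simp_rw [e]
    have hm1 : ∀ n, AEStronglyMeasurable (fun x => (G (w (ns n) x) - G (u x)) • ∇ χ x)
        (volume.restrict Ω) := fun n =>
      ((hG.continuous.comp_aestronglyMeasurable ((hw _).memLp 2).1).sub hmG).smul
        (hχ.memLp_gradient 2).1
    have hm2 : ∀ n, AEStronglyMeasurable
        (fun x => (χ x * deriv G (w (ns n) x)) • (∇ (w (ns n)) x - g x))
        (volume.restrict Ω) := fun n =>
      (hχm.mul (hmw _)).smul (((hw _).memLp_gradient 2).1.sub hgL.1)
    have hm3 : ∀ n, AEStronglyMeasurable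
        (fun x => χ x * (deriv G (w (ns n) x) - deriv G (u x)))
        (volume.restrict Ω) := fun n => hχm.mul ((hmw _).sub hmG')
    have t1 : Tendsto (fun n => ENNReal.ofReal (C * K) *
        eLpNorm (fun x => w (ns n) x - u x) 2 (volume.restrict Ω)) atTop (𝓝 0) := by
      simpa using ENNReal.Tendsto.const_mul hwu (Or.inr ENNReal.ofReal_ne_top)
    have t2 : Tendsto (fun n => ENNReal.ofReal (K * C) *
        eLpNorm (fun x => ∇ (w (ns n)) x - g x) 2 (volume.restrict Ω)) atTop (𝓝 0) := by
      simpa using ENNReal.Tendsto.const_mul hwg (Or.inr ENNReal.ofReal_ne_top)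
    have t3 : Tendsto (fun n => eLpNorm
        (fun x => (χ x * (deriv G (w (ns n) x) - deriv G (u x))) • g x) 2
        (volume.restrict Ω)) atTop (𝓝 0) := by
      refine tendsto_eLpNorm_smul (C := K * (C + C)) hm3 hgL (fun n x => ?_) ?_
      · rw [abs_mul]
        exact mul_le_mul (hK x).1 ((abs_sub _ _).trans (add_le_add (hC' _) (hC' _)))
          (abs_nonneg _) hK0
      · filter_upwards [hae] with x hx
        have h := ((hG'.tendsto (u x)).comp hx).sub_const (deriv G (u x))
        simpa using h.const_mul (χ x)
    refine tendsto_of_tendsto_of_tendsto_of_le_of_le tendsto_const_nhds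
      (by simpa using (t1.add t2).add t3) (fun _ => zero_le) fun n => ?_
    refine (eLpNorm_add_le ((hm1 n).add (hm2 n)) ((hm3 n).smul hgL.1) one_le_two).trans ?_
    refine add_le_add_left ((eLpNorm_add_le (hm1 n) (hm2 n) one_le_two).trans ?_) _
    refine add_le_add
      (eLpNorm_le_mul_eLpNorm_of_ae_le_mul (Eventually.of_forall fun x => ?_) 2)
      (eLpNorm_le_mul_eLpNorm_of_ae_le_mul (Eventually.of_forall fun x => ?_) 2)
    · rw [norm_smul, mul_right_comm]
      exact mul_le_mul (hlip _ _) (hK x).2 (norm_nonneg _) (by positivity)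
    · rw [norm_smul, norm_mul]
      gcongr
      exacts [(hK x).1, hC' _]

/-! ### A smooth bounded extension of `s ↦ (s + ε)⁻¹` -/

/-- For `ε > 0` the function `s ↦ (s + ε)⁻¹` on `[0, ∞)` extends to a smooth function on `ℝ` that
is bounded together with its derivative. -/
theorem exists_smooth_inv_add {ε : ℝ} (hε : 0 < ε) :
    ∃ (G : ℝ → ℝ) (C : ℝ), ContDiff ℝ ∞ G ∧ (∀ s, |G s| ≤ C) ∧ (∀ s, |deriv G s| ≤ C) ∧
      ∀ s, 0 < s → G s = (s + ε)⁻¹ ∧ deriv G s = -((s + ε)⁻¹) ^ 2 := by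
  -- The cut-off vanishes for `s ≤ -ε / 2` and equals `1` for `0 ≤ s`.
  set G : ℝ → ℝ := fun s => Real.smoothTransition (2 * s / ε + 1) * (s + ε)⁻¹ with hGdef
  have hpos : ∀ s, 0 ≤ s → G s = (s + ε)⁻¹ := fun s hs => by
    simp only [hGdef]
    rw [Real.smoothTransition.one_of_one_le (by have := div_nonneg hs hε.le; grind), one_mul]
  have hneg : ∀ s, s ≤ -ε / 2 → G s = 0 := fun s hs => by
    simp only [hGdef]
    rw [Real.smoothTransition.zero_of_nonpos, zero_mul]
    have : 2 * s / ε ≤ -1 := by rw [div_le_iff₀ hε]; linarith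
    linarith
  have hsm : ContDiff ℝ ∞ G := by
    refine contDiff_iff_contDiffAt.2 fun s => ?_
    by_cases hs : s < -ε / 2
    · refine contDiffAt_const (c := (0 : ℝ)) |>.congr_of_eventuallyEq ?_
      filter_upwards [Iio_mem_nhds hs] with t ht using hneg t (le_of_lt ht)
    · have : s + ε ≠ 0 := by intro h; linarith
      refine ContDiffAt.mul ?_ ((contDiffAt_id.add contDiffAt_const).inv this)
      exact Real.smoothTransition.contDiff.contDiffAt.comp s (by fun_prop)
  have dpos : ∀ s, 0 < s → deriv G s = -((s + ε)⁻¹) ^ 2 := fun s hs => by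
    have he : G =ᶠ[𝓝 s] fun t => (t + ε)⁻¹ := by
      filter_upwards [Ioi_mem_nhds hs] with t ht using hpos t (le_of_lt ht)
    rw [he.deriv_eq]
    have hd := ((hasDerivAt_id s).add_const ε).inv (by simp only [id]; positivity)
    simp only [id] at hd
    rw [show (fun t => (t + ε)⁻¹) = (fun t => t + ε)⁻¹ from rfl, hd.deriv, inv_pow, neg_div, one_div]
  have dneg : ∀ s, s < -ε / 2 → deriv G s = 0 := fun s hs => by
    have he : G =ᶠ[𝓝 s] fun _ => (0 : ℝ) := by
      filter_upwards [Iio_mem_nhds hs] with t ht using hneg t (le_of_lt ht)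
    rw [he.deriv_eq, deriv_const]
  obtain ⟨A, hA⟩ := (isCompact_Icc (a := -ε / 2) (b := 0)).exists_bound_of_continuousOn
    hsm.continuous.continuousOn
  obtain ⟨B, hB⟩ := (isCompact_Icc (a := -ε / 2) (b := 0)).exists_bound_of_continuousOn
    (hsm.continuous_deriv (by simp)).continuousOn
  have hinv : ∀ s, 0 < s → (s + ε)⁻¹ ≤ ε⁻¹ := fun s hs => by gcongr; linarith
  refine ⟨G, max (max |A| |B|) (max ε⁻¹ (ε⁻¹ ^ 2)), hsm, fun s => ?_, fun s => ?_,
    fun s hs => ⟨hpos s hs.le, dpos s hs⟩⟩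
  · rcases lt_or_ge s (-ε / 2) with h | h
    · rw [hneg s h.le, abs_zero]
      positivity
    · rcases le_or_gt s 0 with h' | h'
      · exact (hA s ⟨h, h'⟩).trans ((le_abs_self A).trans (by simp))
      · rw [hpos s h'.le, abs_of_pos (by positivity)]
        exact (hinv s h').trans (by simp)
  · rcases lt_or_ge s (-ε / 2) with h | h
    · rw [dneg s h, abs_zero]
      positivity
    · rcases le_or_gt s 0 with h' | h'
      · exact (hB s ⟨h, h'⟩).trans ((le_abs_self B).trans (by simp))
      · rw [dpos s h', abs_neg, abs_of_pos (by positivity)]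
        exact (pow_le_pow_left₀ (by positivity) (hinv s h') 2).trans (by simp)

/-! ### Sublinear nonlinearities -/

/-- As `f s / s` decreases to `θ`, it stays above `θ`. -/
theorem mul_le_of_antitoneOn_div {f : ℝ → ℝ} {θ : ℝ}
    (hf1 : Tendsto (fun s => f s / s) atTop (𝓝 θ))
    (hf2 : AntitoneOn (fun s => f s / s) (Set.Ioi 0)) {s : ℝ} (hs : 0 < s) : θ * s ≤ f s := by
  rw [← le_div_iff₀ hs]
  refine le_of_tendsto hf1 ?_
  filter_upwards [eventually_ge_atTop s] with t ht using hf2 hs (hs.trans_le ht) ht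

theorem exists_mul_inv_add_le_of_antitoneOn_div {f : ℝ → ℝ} (hf : ContinuousOn f (Set.Ici 0))
    (hf0 : ∀ s, 0 ≤ s → 0 ≤ f s)
    (hf2 : AntitoneOn (fun s => f s / s) (Set.Ioi 0)) {ε : ℝ} (hε : 0 < ε) :
    ∃ B, ∀ s, 0 < s → f s * (s + ε)⁻¹ ≤ B := by
  obtain ⟨M, hM⟩ := (isCompact_Icc (a := (0 : ℝ)) (b := 1)).exists_bound_of_continuousOn
    (hf.mono Set.Icc_subset_Ici_self)
  have hM0 : 0 ≤ M := (norm_nonneg _).trans (hM 0 (by simp))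
  have h1 : 0 ≤ f 1 := hf0 1 zero_le_one
  refine ⟨f 1 + M / ε, fun s hs => ?_⟩
  rw [← div_eq_mul_inv, div_le_iff₀ (by positivity)]
  have e : (f 1 + M / ε) * (s + ε) = f 1 * s + f 1 * ε + M / ε * s + M := by field_simp; ring
  have : 0 ≤ M / ε * s := by positivity
  rw [e]
  rcases le_total s 1 with h | h
  · have := (le_abs_self _).trans (hM s ⟨hs.le, h⟩)
    nlinarith [mul_nonneg h1 hs.le, mul_nonneg h1 hε.le]
  · have := hf2 (Set.mem_Ioi.2 one_pos) (Set.mem_Ioi.2 hs) h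
    simp only [div_one] at this
    rw [div_le_iff₀ hs] at this
    nlinarith [mul_nonneg h1 hε.le]

/-! ### Picone's inequality -/

/-- The algebraic form of Picone's inequality: `r` stands for `(u + ε)⁻¹`, `t` for `ψ`, and the
left-hand side is `∇u · ∇(ψ² / (u + ε))`. -/
theorem inner_picone_le {E : Type*} [NormedAddCommGroup E] [InnerProductSpace ℝ E] (g p : E)
    (r t : ℝ) :
    inner ℝ g (r • (t • p + t • p) + (t * t * -r ^ 2) • g) ≤ ‖p‖ ^ 2 := by
  have h := sq_nonneg ‖p - (r * t) • g‖
  rw [norm_sub_sq_real, inner_smul_right, norm_smul, mul_pow, Real.norm_eq_abs, sq_abs] at h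
  rw [inner_add_right, inner_smul_right, inner_smul_right, inner_add_right, inner_smul_right,
    real_inner_self_eq_norm_sq]
  rw [real_inner_comm] at h
  nlinarith

theorem ofReal_integral_norm_sq {α E : Type*} [MeasurableSpace α] {μ : Measure α}
    [NormedAddCommGroup E] {k : α → E} (hk : MemLp k 2 μ) :
    ENNReal.ofReal (∫ x, ‖k x‖ ^ 2 ∂μ) = eLpNorm k 2 μ ^ 2 := by
  rw [ofReal_integral_eq_lintegral_ofReal ((memLp_two_iff_integrable_sq_norm hk.1).1 hk)
    (Eventually.of_forall fun x => sq_nonneg _)]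
  have := eLpNorm_nnreal_pow_eq_lintegral (f := k) (μ := μ) (p := 2) two_ne_zero
  simp only [NNReal.coe_ofNat, ENNReal.coe_ofNat, ENNReal.rpow_ofNat] at this
  rw [this]
  refine lintegral_congr fun x => ?_
  rw [ENNReal.ofReal_pow (norm_nonneg _), ofReal_norm]

theorem integrable_inner_of_memLp {α E : Type*} [MeasurableSpace α] {μ : Measure α}
    [NormedAddCommGroup E] [InnerProductSpace ℝ E] {g h : α → E} (hg : MemLp g 2 μ)
    (hh : MemLp h 2 μ) : Integrable (fun x => inner ℝ (g x) (h x)) μ :=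
  (hg.norm.integrable_mul hh.norm).mono' (hg.1.inner hh.1)
    (Eventually.of_forall fun _ => norm_inner_le_norm _ _)

/-- Testing the equation with `ψ² / (u + ε)` bounds a weighted `L²` norm of `ψ` by its Dirichlet
energy. By monotonicity of `f s / s`, the source term is at least `a u^(-γ) + lam θ u`. The bound
uses the Lebesgue integral with values in `[0, ∞]` so that Fatou's lemma applies directly. -/
theorem IsSolution.lintegral_le {γ : ℝ} {a : EuclideanSpace ℝ (Fin N) → ℝ}
    (ha : ∀ᵐ x ∂(volume.restrict Ω), 0 < a x) {f : ℝ → ℝ} (hf_cont : ContinuousOn f (Set.Ici 0))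
    (hf_nonneg : ∀ s, 0 ≤ s → 0 ≤ f s) {θ : ℝ}
    (hf1 : Tendsto (fun s => f s / s) atTop (𝓝 θ))
    (hf2 : AntitoneOn (fun s => f s / s) (Set.Ioi 0)) {lam : ℝ} (hlam : 0 ≤ lam)
    {u : EuclideanSpace ℝ (Fin N) → ℝ} (hu : IsSolution Ω γ a f lam u)
    {ψ : EuclideanSpace ℝ (Fin N) → ℝ} (hψ : IsTestFunction Ω ψ) {ε : ℝ} (hε : 0 < ε) :
    ∫⁻ x in Ω, ENNReal.ofReal ((a x * u x ^ (-γ) + lam * (θ * u x)) / (u x + ε) * ψ x ^ 2) ≤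
      eLpNorm (∇ ψ) 2 (volume.restrict Ω) ^ 2 := by
  obtain ⟨hu0, g, hg, hsol⟩ := hu
  obtain ⟨G, C, hG, hGC, hGC', hGpos⟩ := exists_smooth_inv_add hε
  have hχ : IsTestFunction Ω (fun x => ψ x * ψ x) := hψ.mul_comp (G := fun s => s) hψ.1 contDiff_id
  have hχ' : ∀ x, ∇ (fun x => ψ x * ψ x) x = ψ x • ∇ ψ x + ψ x • ∇ ψ x := fun x => by
    rw [gradient_mul_comp (G := fun s => s) hψ.differentiable hψ.differentiable differentiable_id,
      deriv_id'', mul_one]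
  have hv := hg.mul_comp hχ hG hGC hGC'
  obtain ⟨hint, heq⟩ := hsol _ _ hv
  have hfm : AEStronglyMeasurable (fun x => f (u x)) (volume.restrict Ω) := by
    have hc : Continuous fun s => f (max s 0) :=
      hf_cont.comp_continuous (continuous_id.max continuous_const) fun s =>
        Set.mem_Ici.2 (le_max_right s 0)
    refine (hc.comp_aestronglyMeasurable hg.1.1.1).congr ?_
    filter_upwards [hu0] with x hx
    simp [hx.le]
  obtain ⟨B, hB⟩ := exists_mul_inv_add_le_of_antitoneOn_div hf_cont hf_nonneg hf2 hε
  -- Without this integrability the term `∫ f(u) v` of the equation would be the junk value `0`.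
  have hfint : Integrable (fun x => f (u x) * (ψ x * ψ x * G (u x))) (volume.restrict Ω) := by
    refine Integrable.mono' ((memLp_one_iff_integrable.1 (hχ.memLp 1)).const_mul B)
      (hfm.mul hv.1.1.1) ?_
    filter_upwards [hu0] with x hx
    rw [(hGpos _ hx).1, Real.norm_of_nonneg (mul_nonneg (hf_nonneg _ hx.le)
      (mul_nonneg (mul_self_nonneg _) (by positivity)))]
    calc f (u x) * (ψ x * ψ x * (u x + ε)⁻¹) = f (u x) * (u x + ε)⁻¹ * (ψ x * ψ x) := by ring
      _ ≤ B * (ψ x * ψ x) := mul_le_mul_of_nonneg_right (hB _ hx) (mul_self_nonneg _)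
  have hsum : Integrable (fun x => a x * u x ^ (-γ) * (ψ x * ψ x * G (u x)) +
      lam * (f (u x) * (ψ x * ψ x * G (u x)))) (volume.restrict Ω) :=
    Integrable.add hint (hfint.const_mul lam)
  rw [← integral_const_mul, ← integral_add hint (hfint.const_mul lam)] at heq
  have hle : ∫ x in Ω, inner ℝ (g x) (G (u x) • ∇ (fun x => ψ x * ψ x) x +
      (ψ x * ψ x * deriv G (u x)) • g x) ≤ ∫ x in Ω, ‖∇ ψ x‖ ^ 2 := by
    refine integral_mono_ae (integrable_inner_of_memLp hg.1.2.1 hv.1.2.1)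
      ((memLp_two_iff_integrable_sq_norm (hψ.memLp_gradient 2).1).1 (hψ.memLp_gradient 2)) ?_
    filter_upwards [hu0] with x hx
    rw [(hGpos _ hx).1, (hGpos _ hx).2, hχ']
    exact inner_picone_le _ _ _ _
  rw [heq] at hle
  rw [← ofReal_integral_norm_sq (hψ.memLp_gradient 2)]
  refine le_trans ?_ (ENNReal.ofReal_le_ofReal hle)
  rw [ofReal_integral_eq_lintegral_ofReal hsum]
  · refine lintegral_mono_ae ?_
    filter_upwards [hu0] with x hx
    refine ENNReal.ofReal_le_ofReal ?_
    rw [(hGpos _ hx).1]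
    have h1 := mul_le_mul_of_nonneg_left (mul_le_of_antitoneOn_div hf1 hf2 hx) hlam
    have h2 : 0 ≤ (u x + ε)⁻¹ * ψ x ^ 2 := by positivity
    have h3 := mul_le_mul_of_nonneg_right h1 h2
    rw [div_eq_mul_inv]
    nlinarith
  · filter_upwards [hu0, ha] with x hx hax
    have h1 := hf_nonneg _ hx.le
    simp only [Pi.zero_apply]
    rw [(hGpos _ hx).1]
    have := mul_self_nonneg (ψ x)
    positivity

/-! ### Comparison with Dirichlet eigenvalues -/

theorem eq_zero_of_integral_mul_self_nonpos {α : Type*} [MeasurableSpace α] {μ : Measure α}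
    {φ : α → ℝ} (hφ : MemLp φ 2 μ) (h : ∫ x, φ x * φ x ∂μ ≤ 0) : φ =ᵐ[μ] 0 := by
  have h0 : 0 ≤ fun x => φ x * φ x := fun x => mul_self_nonneg _
  have := (integral_eq_zero_iff_of_nonneg h0 (hφ.integrable_mul hφ)).1
    (le_antisymm h (integral_nonneg h0))
  filter_upwards [this] with x hx using mul_self_eq_zero.1 hx

theorem IsDirichletEigenvalue.nonneg {δ : ℝ} (hδ : IsDirichletEigenvalue Ω δ) : 0 ≤ δ := by
  obtain ⟨φ, k, hφ, hne, h⟩ := hδ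
  by_contra! hneg
  refine hne (eq_zero_of_integral_mul_self_nonpos hφ.1.1 ?_)
  have h1 : 0 ≤ ∫ x in Ω, inner ℝ (k x) (k x) := integral_nonneg fun x => real_inner_self_nonneg
  rw [h φ k hφ] at h1
  nlinarith

/-- Picone's inequality and Fatou's lemma give
`∫ (a u^(-γ-1) + lam θ) φ² ≤ ∫ |∇φ|²` for every `φ ∈ H₀¹(Ω)`. -/
theorem IsSolution.lintegral_le_of_memH10 {γ : ℝ} {a : EuclideanSpace ℝ (Fin N) → ℝ}
    (ha_int : IntegrableOn a Ω)
    (ha : ∀ᵐ x ∂(volume.restrict Ω), 0 < a x) {f : ℝ → ℝ} (hf_cont : ContinuousOn f (Set.Ici 0))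
    (hf_nonneg : ∀ s, 0 ≤ s → 0 ≤ f s) {θ : ℝ}
    (hf1 : Tendsto (fun s => f s / s) atTop (𝓝 θ))
    (hf2 : AntitoneOn (fun s => f s / s) (Set.Ioi 0)) {lam : ℝ} (hlam : 0 ≤ lam)
    {u : EuclideanSpace ℝ (Fin N) → ℝ} (hu : IsSolution Ω γ a f lam u)
    {φ : EuclideanSpace ℝ (Fin N) → ℝ}
    {k : EuclideanSpace ℝ (Fin N) → EuclideanSpace ℝ (Fin N)} (hφ : MemH10 Ω φ k) :
    ∫⁻ x in Ω, ENNReal.ofReal ((a x * u x ^ (-γ) + lam * (θ * u x)) / u x * φ x ^ 2) ≤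
      eLpNorm k 2 (volume.restrict Ω) ^ 2 := by
  have hmu : AEMeasurable u (volume.restrict Ω) := by
    obtain ⟨-, g, hg, -⟩ := hu
    exact hg.1.1.1.aemeasurable
  have hma : AEMeasurable a (volume.restrict Ω) := ha_int.1.aemeasurable
  obtain ⟨⟨hφL, hkL, -⟩, w, hw, hwφ, hwk⟩ := hφ
  obtain ⟨ns, hns, hae⟩ := exists_ae_tendsto_of_eLpNorm (fun n => (hw n).memLp 2) hφL hwφ
  replace hwk := hwk.comp hns.tendsto_atTop
  -- The test functions `w n` and the regularization `ε = 1 / (n + 1)` pass to the limit together.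
  set F : ℕ → EuclideanSpace ℝ (Fin N) → ENNReal := fun n x => ENNReal.ofReal
    ((a x * u x ^ (-γ) + lam * (θ * u x)) / (u x + 1 / ((n : ℝ) + 1)) * w (ns n) x ^ 2) with hF
  have hFm : ∀ n, AEMeasurable (F n) (volume.restrict Ω) := fun n => by
    have := (hw (ns n)).1.continuous.measurable
    exact ((((hma.mul (hmu.pow_const _)).add ((hmu.const_mul _).const_mul _)).div
      (hmu.add_const _)).mul (this.aemeasurable.pow_const 2)).ennreal_ofReal
  have hlim : ∀ᵐ x ∂(volume.restrict Ω), Tendsto (fun n => F n x) atTop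
      (𝓝 (ENNReal.ofReal ((a x * u x ^ (-γ) + lam * (θ * u x)) / u x * φ x ^ 2))) := by
    filter_upwards [hae, hu.1] with x hx hux
    refine ENNReal.tendsto_ofReal (Tendsto.mul (Tendsto.div tendsto_const_nhds ?_ hux.ne')
      (hx.pow 2))
    simpa using (tendsto_one_div_add_atTop_nhds_zero_nat (𝕜 := ℝ)).const_add (u x)
  calc _ = ∫⁻ x in Ω, liminf (fun n => F n x) atTop := by
        refine lintegral_congr_ae ?_
        filter_upwards [hlim] with x hx using hx.liminf_eq.symm
    _ ≤ liminf (fun n => ∫⁻ x in Ω, F n x) atTop := lintegral_liminf_le' hFm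
    _ ≤ liminf (fun n => (eLpNorm (fun x => ∇ (w (ns n)) x - k x) 2 (volume.restrict Ω) +
          eLpNorm k 2 (volume.restrict Ω)) ^ 2) atTop := by
        refine liminf_le_liminf (Eventually.of_forall fun n => ?_)
        refine (hu.lintegral_le ha hf_cont hf_nonneg hf1 hf2 hlam (hw (ns n))
          (ε := 1 / ((n : ℝ) + 1)) (by positivity)).trans ?_
        gcongr
        refine le_trans (le_of_eq ?_) (eLpNorm_add_le (((hw _).memLp_gradient 2).1.sub hkL.1) hkL.1
          one_le_two)
        congr 1
        ext1 x
        simp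
    _ = _ := by
        refine Tendsto.liminf_eq ?_
        have := hwk.add_const (eLpNorm k 2 (volume.restrict Ω))
        rw [zero_add] at this
        exact ENNReal.Tendsto.pow this

/-- A positive solution forces `lam θ` below every Dirichlet eigenvalue: with an eigenfunction
`φ`, the weighted inequality reads `∫ (a u^(-γ-1) + lam θ) φ² ≤ δ ∫ φ²`. -/
theorem IsSolution.mul_lt_of_isDirichletEigenvalue {γ : ℝ} {a : EuclideanSpace ℝ (Fin N) → ℝ}
    (ha_int : IntegrableOn a Ω)
    (ha : ∀ᵐ x ∂(volume.restrict Ω), 0 < a x) {f : ℝ → ℝ} (hf_cont : ContinuousOn f (Set.Ici 0))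
    (hf_nonneg : ∀ s, 0 ≤ s → 0 ≤ f s) {θ : ℝ} (hθ : 0 < θ)
    (hf1 : Tendsto (fun s => f s / s) atTop (𝓝 θ))
    (hf2 : AntitoneOn (fun s => f s / s) (Set.Ioi 0)) {lam : ℝ} (hlam : 0 ≤ lam)
    {u : EuclideanSpace ℝ (Fin N) → ℝ} (hu : IsSolution Ω γ a f lam u) {δ : ℝ}
    (hδ : IsDirichletEigenvalue Ω δ) : lam * θ < δ := by
  obtain ⟨φ, k, hφ, hne, heig⟩ := hδ
  by_contra! hle
  refine hne ?_
  have hfatou := hu.lintegral_le_of_memH10 ha_int ha hf_cont hf_nonneg hf1 hf2 hlam hφ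
  have hsq : Integrable (fun x => φ x * φ x) (volume.restrict Ω) := hφ.1.1.integrable_mul hφ.1.1
  have hc : 0 ≤ lam * θ := by positivity
  have hupper : eLpNorm k 2 (volume.restrict Ω) ^ 2 ≤
      ∫⁻ x in Ω, ENNReal.ofReal (lam * θ * (φ x * φ x)) := by
    rw [← ofReal_integral_norm_sq hφ.1.2.1, ← ofReal_integral_eq_lintegral_ofReal
      (hsq.const_mul _) (Eventually.of_forall fun x => mul_nonneg hc (mul_self_nonneg _)),
      integral_const_mul]
    simp_rw [← real_inner_self_eq_norm_sq]
    rw [heig φ k hφ]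
    exact ENNReal.ofReal_le_ofReal (mul_le_mul_of_nonneg_right hle
      (integral_nonneg fun x => mul_self_nonneg _))
  have hmu : AEMeasurable u (volume.restrict Ω) := by
    obtain ⟨-, g, hg, -⟩ := hu
    exact hg.1.1.1.aemeasurable
  have hsplit : ∀ᵐ x ∂(volume.restrict Ω),
      (a x * u x ^ (-γ) + lam * (θ * u x)) / u x * φ x ^ 2 =
        a x * u x ^ (-γ) / u x * φ x ^ 2 + lam * θ * (φ x * φ x) := by
    filter_upwards [hu.1] with x hx
    field_simp
  -- The reverse inequality of integrals forces equality almost everywhere in `lam θ φ² ≤ W φ²`,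
  -- where `W = a u^(-γ-1) + lam θ`, and the excess `a u^(-γ-1)` is positive.
  have hEq : (fun x => ENNReal.ofReal (lam * θ * (φ x * φ x))) =ᵐ[volume.restrict Ω]
      fun x => ENNReal.ofReal ((a x * u x ^ (-γ) + lam * (θ * u x)) / u x * φ x ^ 2) := by
    refine ae_eq_of_ae_le_of_lintegral_le ?_ (hsq.const_mul _).lintegral_lt_top.ne
      ((((ha_int.1.aemeasurable.mul (hmu.pow_const _)).add
        ((hmu.const_mul _).const_mul _)).div hmu).mul
        (hφ.1.1.1.aemeasurable.pow_const 2)).ennreal_ofReal (hfatou.trans hupper)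
    filter_upwards [hu.1, ha, hsplit] with x hx hax hs
    refine ENNReal.ofReal_le_ofReal ?_
    rw [hs]
    have : 0 ≤ a x * u x ^ (-γ) / u x * φ x ^ 2 := by positivity
    linarith
  filter_upwards [hEq, hsplit, hu.1, ha] with x hx hs hux hax
  have hp : 0 < a x * u x ^ (-γ) / u x := by positivity
  have hn : 0 ≤ a x * u x ^ (-γ) / u x * φ x ^ 2 := by positivity
  have hn' : 0 ≤ lam * θ * (φ x * φ x) := mul_nonneg hc (mul_self_nonneg _)
  rw [hs, ENNReal.ofReal_eq_ofReal_iff hn' (add_nonneg hn hn')] at hx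
  have h0 : a x * u x ^ (-γ) / u x * φ x ^ 2 = 0 := by linarith
  simpa [hp.ne'] using h0

end SingularElliptic

theorem lemma2p2 (N : ℕ) (hN : 3 ≤ N)
    (Ω : Set (EuclideanSpace ℝ (Fin N))) (hΩ : SingularElliptic.IsSmoothBoundedDomain Ω)
    (γ : ℝ) (hγ : 0 < γ)
    (a : EuclideanSpace ℝ (Fin N) → ℝ) (ha_int : IntegrableOn a Ω)
    (ha_pos : ∀ᵐ x ∂(volume.restrict Ω), 0 < a x)
    (f : ℝ → ℝ) (hf_cont : ContinuousOn f (Set.Ici 0)) (hf_nonneg : ∀ s, 0 ≤ s → 0 ≤ f s)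
    (θ : ℝ) (hθ : 0 < θ) (hf1 : Tendsto (fun s => f s / s) atTop (𝓝 θ))
    (hf2 : AntitoneOn (fun s => f s / s) (Set.Ioi 0))
    (δ₁ : ℝ) (hδ₁ : IsLeast {μ : ℝ | SingularElliptic.IsDirichletEigenvalue Ω μ} δ₁) :
    (∀ lam : ℝ, 0 ≤ lam → (∃ u, SingularElliptic.IsSolution Ω γ a f lam u) →
      lam ∈ Set.Ico 0 (δ₁ / θ)) ∧
    (∀ lam : ℝ, δ₁ / θ ≤ lam → ¬ ∃ u, SingularElliptic.IsSolution Ω γ a f lam u) := by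
  have key : ∀ lam : ℝ, 0 ≤ lam → (∃ u, SingularElliptic.IsSolution Ω γ a f lam u) →
      lam < δ₁ / θ := fun lam hlam ⟨u, hu⟩ => (lt_div_iff₀ hθ).2
    (hu.mul_lt_of_isDirichletEigenvalue ha_int ha_pos hf_cont hf_nonneg hθ hf1 hf2 hlam hδ₁.1)
  exact ⟨fun lam hlam h => ⟨hlam, key lam hlam h⟩, fun lam hle h =>
    (key lam ((div_nonneg hδ₁.1.nonneg hθ.le).trans hle) h).not_ge hle⟩
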